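/- Let $\mathcal{D}\supseteq\mathbb{Q}$ be an ordinary differential domain with derivation $\partial$, let $U=\{u_1,\dots,u_{n-1}\}$ be differential indeterminates over $\mathcal{D}$, write $u_{j,k}=\partial^k u_j$, and let $\mathcal{D}\{U^{\pm}\}=\mathcal{D}[u_{j,k},u_{j,k}^{-1}]$ be the differential ring of Laurent differential polynomials. For $f\in\mathcal{D}\{U^{\pm}\}$ let $\mathfrak{S}_j(f)$ be the set of $k$ such that $u_{j,k}$ occurs in a monomial of $f$, and ${\rm ord}(f,u_j)=\max\mathfrak{S}_j(f)$ (which is $-\infty$ if $\mathfrak{S}_j(f)=\emptyset$). Let $\mathcal{P}=\{f_1,\dots,f_n\}\subset\mathcal{D}\{U^{\pm}\}$ be a system of $n$ distinct Laurent differential polynomials such that each $f_i$ involves some element of $\{u_{j,k}\}$ and each $u_j$ occurs, possibly differentiated, in some $f_i$. Put $o_{i,j}={\rm ord}(f_i,u_j)$, let $\gamma_j$ be the least element of $\bigcup_i\mathfrak{S}_j(f_i)$, $\gamma=\sum_j\gamma_j$, and let $J_i=\max_\mu\sum_{l\neq i}o_{l,\mu(l)}$, the maximum being over the bijections $\mu:\{1,\dots,n\}\setminus\{i\}\to\{1,\dots,n-1\}$.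 Let $X$ be the $n\times(n-1)$ matrix whose $(i,j)$ entry is an algebraic indeterminate $x_{i,j}$ over $\mathbb{Q}$ if $\mathfrak{S}_j(f_i)\neq\emptyset$ and $0$ otherwise; assume that $\mathcal{P}$ is super essential, that is, all the $(n-1)\times(n-1)$ minors of $X$ are nonzero. For each $i$ choose a monomial $M_i$ of $f_i$. Let $\mathfrak{a}_1,\dots,\mathfrak{a}_n$ be differential indeterminates, $\tilde{\mathcal{D}}=\mathcal{D}\{\mathfrak{a}_1,\dots,\mathfrak{a}_n\}$, and let $\tilde{\mathcal{P}}=\{F_1,\dots,F_n\}\subset\tilde{\mathcal{D}}\{U^{\pm}\}$, where $F_i$ is obtained from $f_i$ by replacing the coefficient of $M_i$ by $\mathfrak{a}_i$. (The numbers $o_{i,j},\gamma_j,\gamma,J_i$ are the same for $\tilde{\mathcal{P}}$.) Let ${\rm ps}(\tilde{\mathcal{P}})=\{\partial^kF_i\mid 1\le i\le n,\ 0\le k\le J_i-\gamma\}=\{\rho(1),\dots,\rho(L)\}$. Its elements involve only variables from $\mathcal{V}=\{u_{j,k}\mid\gamma_j\le k\le\max_i(o_{i,j}+J_i)-\gamma\}$.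 Let $\mathcal{Y}$ be a set of algebraic indeterminates with a bijection $\upsilon:\mathcal{Y}\to\mathcal{V}$, extended to Laurent monomials. For $l=1,\dots,L$ write $\rho(l)=\sum_{\alpha\in\mathcal{A}_l}a^l_\alpha\,\upsilon(y^\alpha)$ with $a^l_\alpha\neq0$. Let $\mathcal{C}=\{c^l_\alpha\mid 1\le l\le L,\ \alpha\in\mathcal{A}_l\}$ be algebraic indeterminates over $\mathbb{Q}$, put $P_l=\sum_{\alpha\in\mathcal{A}_l}c^l_\alpha y^\alpha$ and ${\rm ags}(\tilde{\mathcal{P}})=\{P_1,\dots,P_L\}$, and let $({\rm ags}(\tilde{\mathcal{P}}))$ be the ideal that it generates in $\mathbb{Q}[\mathcal{C}][\mathcal{Y}^{\pm}]$. Put $\Xi(c^l_\alpha)=a^l_\alpha\in\tilde{\mathcal{D}}$. For $\Delta\subseteq\mathcal{C}$ let $\Xi_\Delta$ be the partial specialization that replaces every $c\in\Delta$ by $\Xi(c)$ and fixes the other elements of $\mathcal{C}$. Given a nonzero $Q\in({\rm ags}(\tilde{\mathcal{P}}))\cap\mathbb{Q}[\mathcal{C}]$, consider the following algorithm. 1.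 Let $\Delta:=\emptyset$, $H:=Q$. 2. If $\mathcal{C}\setminus\Delta=\emptyset$, return $H$ (which is then free of the indeterminates $\mathcal{C}$). 3. Choose any $c\in\mathcal{C}\setminus\Delta$ and let $\Delta:=\Delta\cup\{c\}$. 4. If $\Xi_\Delta(H)\neq0$, let $H:=\Xi_\Delta(H)$ and go to step 2. 5. Otherwise write $H=(c-\Xi(c))^s\,\overline{H}$ with $s\ge1$ and $\Xi_\Delta(\overline{H})\neq0$, let $H:=\Xi_\Delta(\overline{H})$ and go to step 2. **Theorem.** For every nonzero $Q\in({\rm ags}(\tilde{\mathcal{P}}))\cap\mathbb{Q}[\mathcal{C}]$ and all choices in step 3, the algorithm is well defined (the factorization in step 5 always exists and the next $H$ is unique) and terminates, and its output is a nonzero differential polynomial in the differential elimination ideal $[\tilde{\mathcal{P}}]\cap\tilde{\mathcal{D}}$, where $[\tilde{\mathcal{P}}]$ is the differential ideal generated by $\tilde{\mathcal{P}}$ in $\tilde{\mathcal{D}}\{U^{\pm}\}$. -/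

import Mathlib

open scoped Differential

noncomputable section

namespace DiffSpec

/-! ### Differential rings and differential ideals -/

/-- The differential ideal generated by a subset `S` of a differential ring: the smallest ideal
that contains `S` and is stable under the derivation. -/
def diffIdeal {A : Type*} [CommRing A] [Differential A] (S : Set A) : Ideal A :=
  sInf {I : Ideal A | S ⊆ I ∧ ∀ x ∈ I, x′ ∈ I}

section Coeff

variable (R : Type*) [CommRing R] [Differential R] (E : Type*) [AddCommMonoid E]

/-- The derivation of `R[E]` that differentiates the coefficients and kills the monomials. -/
def coeffDeriv : Derivation ℤ (AddMonoidAlgebra R E) (AddMonoidAlgebra R E) :=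
  Derivation.mk'
    (AddMonoidHom.toIntLinearMap
      { toFun := AddMonoidAlgebra.map
          (Differential.deriv : Derivation ℤ R R).toLinearMap.toAddMonoidHom
        map_zero' := by simp
        map_add' := fun x y => by simp [AddMonoidAlgebra.map_add] })
    (by
      intro a b
      induction a using AddMonoidAlgebra.induction_linear with
      | zero => simp
      | add x y hx hy => simp only [add_mul, map_add, hx, hy, smul_eq_mul, mul_add]; abel
      | single α r =>
        induction b using AddMonoidAlgebra.induction_linear with
        | zero => simp
        | add x y hx hy => simp only [add_mul, map_add, hx, hy, smul_eq_mul, mul_add]; abel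
        | single β s =>
          simp [AddMonoidAlgebra.single_mul_single, add_comm β α])

theorem coeffDeriv_single (α : E) (r : R) :
    coeffDeriv R E (AddMonoidAlgebra.single α r) = AddMonoidAlgebra.single α (r′) := by
  simp [coeffDeriv]

end Coeff

/-- The ring `R{x_i | i ∈ ι}` of differential polynomials; the variable `(i, k)` is the `k`-th
derivative of the differential indeterminate `x_i`. -/
abbrev DiffPoly (R : Type*) [CommRing R] (ι : Type*) := MvPolynomial (ι × ℕ) R

/-- The derivation of `R{x_i}` extends that of `R` and maps `x_{i,k}` to `x_{i,k+1}`. -/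
instance diffPolyDifferential (R : Type*) [CommRing R] [Differential R] (ι : Type*) :
    Differential (DiffPoly R ι) where
  deriv := coeffDeriv R ((ι × ℕ) →₀ ℕ) +
    (MvPolynomial.mkDerivation R
      (fun v : ι × ℕ => (MvPolynomial.X (v.1, v.2 + 1) : DiffPoly R ι))).restrictScalars ℤ

theorem diffPoly_deriv_C (R : Type*) [CommRing R] [Differential R] (ι : Type*) (r : R) :
    (MvPolynomial.C r : DiffPoly R ι)′ = MvPolynomial.C (r′) := by
  have h : coeffDeriv R ((ι × ℕ) →₀ ℕ) (MvPolynomial.C r) = MvPolynomial.C (r′) :=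
    coeffDeriv_single R _ 0 r
  change coeffDeriv R ((ι × ℕ) →₀ ℕ) (MvPolynomial.C r) +
    MvPolynomial.mkDerivation R _ (MvPolynomial.C r) = _
  rw [h, MvPolynomial.derivation_C, add_zero]

theorem diffPoly_deriv_X (R : Type*) [CommRing R] [Differential R] (ι : Type*) (i : ι) (k : ℕ) :
    (MvPolynomial.X (i, k) : DiffPoly R ι)′ = MvPolynomial.X (i, k + 1) := by
  have h : coeffDeriv R ((ι × ℕ) →₀ ℕ) (MvPolynomial.X (i, k)) = 0 := by
    refine (coeffDeriv_single R _ (Finsupp.single (i, k) 1) 1).trans ?_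
    simp
  change coeffDeriv R ((ι × ℕ) →₀ ℕ) (MvPolynomial.X (i, k)) +
    MvPolynomial.mkDerivation R _ (MvPolynomial.X (i, k)) = _
  rw [h, MvPolynomial.mkDerivation_X, zero_add]

/-- The ring `R{U^±}` of Laurent differential polynomials in `u_i`, `i ∈ ι`; the variable `(i, k)`
is the `k`-th derivative of `u_i`, and `AddMonoidAlgebra.single α a` is the term `a u^α`. -/
abbrev LaurentDiffPoly (R : Type*) [CommRing R] (ι : Type*) :=
  AddMonoidAlgebra R ((ι × ℕ) →₀ ℤ)

section Laurent

variable (R : Type*) [CommRing R] (ι : Type*)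

/-- The logarithmic derivative `∑ α_v u_{v+1} / u_v` of the Laurent monomial `u^α`. -/
def logDeriv (α : (ι × ℕ) →₀ ℤ) : LaurentDiffPoly R ι :=
  α.sum fun v a => AddMonoidAlgebra.single
    (Finsupp.single (v.1, v.2 + 1) (1 : ℤ) - Finsupp.single v 1) (a : R)

theorem logDeriv_add (α β : (ι × ℕ) →₀ ℤ) :
    logDeriv R ι (α + β) = logDeriv R ι α + logDeriv R ι β := by
  classical
  exact Finsupp.sum_add_index' (by simp) (by simp)

/-- The `R`-linear derivation of `R{U^±}` that maps `u_{i,k}` to `u_{i,k+1}`. -/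
def shiftDeriv : Derivation ℤ (LaurentDiffPoly R ι) (LaurentDiffPoly R ι) :=
  Derivation.mk'
    (AddMonoidHom.toIntLinearMap
      (AddMonoidAlgebra.liftNC
        ((AddMonoidAlgebra.singleAddHom 0 : R →+ LaurentDiffPoly R ι))
        fun α => AddMonoidAlgebra.single α.toAdd 1 * logDeriv R ι α.toAdd))
    (by
      intro a b
      induction a using AddMonoidAlgebra.induction_linear with
      | zero => simp
      | add x y hx hy => simp only [add_mul, map_add, hx, hy, smul_eq_mul, mul_add]; abel
      | single α r =>
        induction b using AddMonoidAlgebra.induction_linear with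
        | zero => simp
        | add x y hx hy => simp only [add_mul, map_add, hx, hy, smul_eq_mul, mul_add]; abel
        | single β s =>
          simp only [AddMonoidAlgebra.single_mul_single, AddMonoidHom.coe_toIntLinearMap,
            AddMonoidAlgebra.liftNC_single, AddMonoidAlgebra.singleAddHom_apply, smul_eq_mul,
            toAdd_ofAdd, logDeriv_add, mul_add, ← mul_assoc, zero_add, mul_one]
          rw [add_comm β α, mul_comm s r, add_comm])

theorem shiftDeriv_single (α : (ι × ℕ) →₀ ℤ) (r : R) :
    shiftDeriv R ι (AddMonoidAlgebra.single α r) =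
      AddMonoidAlgebra.single α r * logDeriv R ι α := by
  simp [shiftDeriv, ← mul_assoc, AddMonoidAlgebra.single_mul_single]

end Laurent

/-- The derivation of `R{U^±}` extends that of `R` and maps `u_{i,k}` to `u_{i,k+1}`. -/
instance laurentDifferential (R : Type*) [CommRing R] [Differential R] (ι : Type*) :
    Differential (LaurentDiffPoly R ι) where
  deriv := coeffDeriv R ((ι × ℕ) →₀ ℤ) + shiftDeriv R ι

theorem laurent_deriv_single (R : Type*) [CommRing R] [Differential R] (ι : Type*)
    (α : (ι × ℕ) →₀ ℤ) (r : R) :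
    (AddMonoidAlgebra.single α r : LaurentDiffPoly R ι)′ =
      AddMonoidAlgebra.single α (r′) + AddMonoidAlgebra.single α r * logDeriv R ι α := by
  change coeffDeriv R ((ι × ℕ) →₀ ℤ) _ + shiftDeriv R ι _ = _
  rw [coeffDeriv_single, shiftDeriv_single]

theorem laurent_deriv_var (R : Type*) [CommRing R] [Differential R] (ι : Type*)
    (i : ι) (k : ℕ) :
    (AddMonoidAlgebra.single (Finsupp.single (i, k) 1) 1 : LaurentDiffPoly R ι)′ =
      AddMonoidAlgebra.single (Finsupp.single (i, k + 1) 1) 1 := by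
  rw [laurent_deriv_single]
  simp [logDeriv, AddMonoidAlgebra.single_mul_single]

/-! ### Systems of `m + 1` Laurent differential polynomials in `m` differential indeterminates -/

section System

variable {R : Type*} [CommRing R] {m : ℕ}

/-- The differential support of `f` in `u_j`: the `k` such that `u_{j,k}` occurs (with a nonzero
exponent) in a monomial of `f`. -/
def diffSupport (f : LaurentDiffPoly R (Fin m)) (j : Fin m) : Finset ℕ :=
  ((f.coeff.support.biUnion fun α => α.support).filter fun v => v.1 = j).image Prod.snd

/-- The order of `f` in `u_j`, with `⊥` in the role of `-∞`. -/
def ord (f : LaurentDiffPoly R (Fin m)) (j : Fin m) : WithBot ℕ :=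
  (diffSupport f j).max

/-- The Jacobi number `J_i`: the maximum of the diagonal sums of the order matrix of the system
without `f_i`. -/
def jacobi (f : Fin (m + 1) → LaurentDiffPoly R (Fin m)) (i : Fin (m + 1)) : WithBot ℕ :=
  Finset.univ.sup fun σ : Equiv.Perm (Fin m) => ∑ k, ord (f (i.succAbove k)) (σ k)

/-- `γ_j`, the least order of derivation of `u_j` that occurs in the system. -/
def gammaAt (f : Fin (m + 1) → LaurentDiffPoly R (Fin m)) (j : Fin m) : ℕ :=
  sInf {k | ∃ i, k ∈ diffSupport (f i) j}

/-- `γ = ∑_j γ_j`. -/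
def gamma (f : Fin (m + 1) → LaurentDiffPoly R (Fin m)) : ℕ :=
  ∑ j, gammaAt f j

open Classical in
/-- The matrix `X(𝒫)`: an algebraic indeterminate `x_{i,j}` where `u_j` occurs in `f_i`, and zero
elsewhere. -/
def suppMatrix (f : Fin (m + 1) → LaurentDiffPoly R (Fin m)) :
    Matrix (Fin (m + 1)) (Fin m) (MvPolynomial (Fin (m + 1) × Fin m) ℚ) :=
  fun i j => if (diffSupport (f i) j).Nonempty then MvPolynomial.X (i, j) else 0

/-- The system is super essential: all maximal minors of `X(𝒫)` are nonzero. -/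
def SuperEssential (f : Fin (m + 1) → LaurentDiffPoly R (Fin m)) : Prop :=
  ∀ i : Fin (m + 1), ((suppMatrix f).submatrix i.succAbove id).det ≠ 0

/-- The index set of `ps(𝒫)`: the pairs `(i, k)` with `0 ≤ k ≤ J_i - γ`. -/
def PsIdx (f : Fin (m + 1) → LaurentDiffPoly R (Fin m)) : Type :=
  {p : Fin (m + 1) × ℕ // ((p.2 + gamma f : ℕ) : WithBot ℕ) ≤ jacobi f p.1}

/-- The element `∂^k f_i` of `ps(𝒫)` with index `(i, k)`. -/
def ps [Differential R] (f : Fin (m + 1) → LaurentDiffPoly R (Fin m)) (l : PsIdx f) :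
    LaurentDiffPoly R (Fin m) :=
  (fun g : LaurentDiffPoly R (Fin m) => g′)^[l.1.2] (f l.1.1)

/-- The set `𝒱(𝒫)` of the `u_{j,k}` with `γ_j ≤ k ≤ max_i (o_{i,j} + J_i) - γ`. -/
def VarIdx (f : Fin (m + 1) → LaurentDiffPoly R (Fin m)) : Type :=
  {v : Fin m × ℕ // gammaAt f v.1 ≤ v.2 ∧
    ((v.2 + gamma f : ℕ) : WithBot ℕ) ≤ Finset.univ.sup fun i => ord (f i) v.1 + jacobi f i}

/-- The exponent in the variables `{U}` of the monomial `υ(y^α)`. -/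
def liftExp (f : Fin (m + 1) → LaurentDiffPoly R (Fin m)) (α : VarIdx f →₀ ℤ) :
    (Fin m × ℕ) →₀ ℤ :=
  α.embDomain (Function.Embedding.subtype _)

/-- The algebraic support of `g` in the variables `𝒱(𝒫)`. -/
def algSupport (f : Fin (m + 1) → LaurentDiffPoly R (Fin m)) (g : LaurentDiffPoly R (Fin m)) :
    Finset (VarIdx f →₀ ℤ) :=
  g.coeff.support.preimage (liftExp f) (Finsupp.embDomain_injective _).injOn

/-- The set `𝒞` of the coefficients `c^l_α` of the algebraic generic system. -/
def CIdx [Differential R] (f : Fin (m + 1) → LaurentDiffPoly R (Fin m)) : Type :=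
  Σ l : PsIdx f, {α : VarIdx f →₀ ℤ // α ∈ algSupport f (ps f l)}

/-- The Laurent polynomial ring `ℚ[𝒞][𝒴^±]`; the set `𝒴` of algebraic indeterminates is indexed
by `𝒱(𝒫)`, through the bijection `υ`. -/
abbrev GenericRing [Differential R] (f : Fin (m + 1) → LaurentDiffPoly R (Fin m)) :=
  AddMonoidAlgebra (MvPolynomial (CIdx f) ℚ) (VarIdx f →₀ ℤ)

/-- The algebraic generic system `ags(𝒫)`: the polynomials `P_l = ∑_α c^l_α y^α`. -/
def ags [Differential R] (f : Fin (m + 1) → LaurentDiffPoly R (Fin m)) (l : PsIdx f) :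
    GenericRing f :=
  ∑ α ∈ (algSupport f (ps f l)).attach,
    AddMonoidAlgebra.single α.1 (MvPolynomial.X (⟨l, α⟩ : CIdx f))

/-- The elimination ideal `(ags(𝒫)) ∩ ℚ[𝒞]`. -/
def elimIdeal [Differential R] (f : Fin (m + 1) → LaurentDiffPoly R (Fin m)) :
    Ideal (MvPolynomial (CIdx f) ℚ) :=
  (Ideal.span (Set.range (ags f))).comap
    (algebraMap (MvPolynomial (CIdx f) ℚ) (GenericRing f))

/-- The specialization map `Ξ`: it sends `c^l_α` to the coefficient of `υ(y^α)` in the `l`-th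
element of `ps(𝒫)`. -/
def Xi [Differential R] (f : Fin (m + 1) → LaurentDiffPoly R (Fin m)) (c : CIdx f) : R :=
  (ps f c.1).coeff (liftExp f c.2.1)

/-- The system `𝒫̃`: the coefficient of the chosen monomial `M_i` of `f_i` is replaced by the new
differential indeterminate `𝔞_i`, the other coefficients are kept. -/
def tildeSystem (f : Fin (m + 1) → LaurentDiffPoly R (Fin m))
    (M : Fin (m + 1) → ((Fin m × ℕ) →₀ ℤ)) (i : Fin (m + 1)) :
    LaurentDiffPoly (DiffPoly R (Fin (m + 1))) (Fin m) :=
  ((AddMonoidAlgebra.map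
    ((MvPolynomial.C : R →+* DiffPoly R (Fin (m + 1))) : R →+ DiffPoly R (Fin (m + 1)))
    (f i)).update (M i) (MvPolynomial.X (i, 0)))

end System

/-! ### The specialization algorithm

The polynomials handled by the algorithm lie in `ℚ[(𝒞 ∖ Δ) ∪ Ξ(Δ)]`. They are regarded as
polynomials in the indeterminates `𝒞` over a ring `S` that contains the values of `Ξ`. -/

section Algorithm

variable {𝒞 S : Type*} [CommRing S]

open Classical in
/-- The partial specialization `Ξ_Δ`: it replaces `c` by `Ξ(c)` for `c ∈ Δ`, and fixes the other
indeterminates. -/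
def partialSpec (Ξ : 𝒞 → S) (Δ : Set 𝒞) : MvPolynomial 𝒞 S →ₐ[S] MvPolynomial 𝒞 S :=
  MvPolynomial.aeval fun c => if c ∈ Δ then MvPolynomial.C (Ξ c) else MvPolynomial.X c

/-- One round of the algorithm for the chosen indeterminate `c`, from the polynomial `H` to the
next polynomial; `Δ` is the set of indeterminates chosen so far, including `c`. -/
inductive Round (Ξ : 𝒞 → S) (Δ : Set 𝒞) (c : 𝒞) (H : MvPolynomial 𝒞 S) :
    MvPolynomial 𝒞 S → Prop
  | specialize (h : partialSpec Ξ Δ H ≠ 0) : Round Ξ Δ c H (partialSpec Ξ Δ H)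
  | divide (s : ℕ) (Hbar : MvPolynomial 𝒞 S) (h : partialSpec Ξ Δ H = 0) (hs : 0 < s)
      (hH : H = (MvPolynomial.X c - MvPolynomial.C (Ξ c)) ^ s * Hbar)
      (hbar : partialSpec Ξ Δ Hbar ≠ 0) : Round Ξ Δ c H (partialSpec Ξ Δ Hbar)

/-- The states of the algorithm: the set `Δ` of specialized indeterminates and the current
polynomial `H`. -/
structure State (𝒞 S : Type*) [CommRing S] where
  /-- the indeterminates that have been specialized -/
  Δ : Set 𝒞
  /-- the current polynomial -/
  H : MvPolynomial 𝒞 S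

/-- A transition of the algorithm: some `c ∉ Δ` is chosen, added to `Δ`, and specialized. -/
def Step (Ξ : 𝒞 → S) (s t : State 𝒞 S) : Prop :=
  ∃ c, c ∉ s.Δ ∧ t.Δ = insert c s.Δ ∧ Round Ξ t.Δ c s.H t.H

/-- The initial state on input `Q`: nothing is specialized. -/
def initial [Algebra ℚ S] (Q : MvPolynomial 𝒞 ℚ) : State 𝒞 S :=
  ⟨∅, MvPolynomial.map (algebraMap ℚ S) Q⟩

/-- A state that occurs in some run of the algorithm on input `Q`. -/
def Reachable [Algebra ℚ S] (Ξ : 𝒞 → S) (Q : MvPolynomial 𝒞 ℚ) (s : State 𝒞 S) : Prop :=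
  Relation.ReflTransGen (Step Ξ) (initial Q) s

/-- The output `Ξ_{𝒴^±}(H)` for a polynomial `H` that remains when `Δ = 𝒞`. Such an `H` is free of
the indeterminates `𝒞` and does not involve `𝒴`, so it is an element `h` of the coefficient
ring `S`. -/
def IsOutput [Algebra ℚ S] (Ξ : 𝒞 → S) (Q : MvPolynomial 𝒞 ℚ) (h : S) : Prop :=
  Reachable Ξ Q ⟨Set.univ, MvPolynomial.C h⟩

end Algorithm

end DiffSpec

end

open scoped Differential

noncomputable section

namespace DiffSpec

/-! ### The specialization algorithm over a domain -/

section Algorithm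

open MvPolynomial

variable {𝒞 S : Type*} [CommRing S] (Ξ : 𝒞 → S)

/-! Finiteness of `𝒞` bounds every run. A round divides out the exact power of `c - Ξ(c)`, so over a
domain its result exists, is unique and is nonzero (`existsUnique_round`). The substance is
membership in `[𝒫̃]`: dividing by a factor that specializes to zero must not lead out of the ideal.

Since `𝔞_i` is the coefficient of a single invertible monomial of `F_i`, the equation `F_i = b_i`
can be solved for it: `𝔞_i = u^{-M_i} (b_i - rest)`. With the `b_i` as new differential
indeterminates, `∂^k F_i` becomes the variable `b_{i,k}`, and an element of `𝒟̃` whose image has no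
constant term in the `b_{i,k}` lies in `[𝒫̃]` (`mem_diffIdeal_of_constantCoeff_eq_zero`).

Now deform: send `c` to `c + Ξ(c)` and set `b_{i,k} = -∑ c_α υ(y^α)` for the members of `ps`. Every
`P_l` becomes `∑ c_α υ(y^α) + b_{i,k} = 0`, hence so does `Q` (`genericPointLaurent_ags`,
`genericPoint_eq_zero`). In these coordinates specializing `c` to `Ξ(c)` means setting `c = 0`, and
`c - Ξ(c)` is the variable `c` itself, a nonzero element of a domain as long as `c` is
unspecialized. So it can be cancelled, and vanishing survives each round
(`Reachable.apply_eq_zero`). When all `c` are zero, so are the `b_{i,k}`, and the output vanishes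
modulo `b = 0`. -/

theorem partialSpec_X_mem {Δ : Set 𝒞} {c : 𝒞} (hc : c ∈ Δ) :
    partialSpec Ξ Δ (X c) = C (Ξ c) := by
  simp [partialSpec, hc]

theorem partialSpec_X_notMem {Δ : Set 𝒞} {c : 𝒞} (hc : c ∉ Δ) :
    partialSpec Ξ Δ (X c) = X c := by
  simp [partialSpec, hc]

theorem partialSpec_C (Δ : Set 𝒞) (r : S) : partialSpec Ξ Δ (C r) = C r :=
  (partialSpec Ξ Δ).commutes r

theorem partialSpec_partialSpec {Δ Δ' : Set 𝒞} (h : Δ ⊆ Δ') (H : MvPolynomial 𝒞 S) :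
    partialSpec Ξ Δ' (partialSpec Ξ Δ H) = partialSpec Ξ Δ' H := by
  refine DFunLike.congr_fun (?_ : (partialSpec Ξ Δ').comp (partialSpec Ξ Δ) = partialSpec Ξ Δ') H
  ext1 d
  rw [AlgHom.comp_apply]
  by_cases hd : d ∈ Δ
  · rw [partialSpec_X_mem Ξ hd, partialSpec_X_mem Ξ (h hd), partialSpec_C]
  · rw [partialSpec_X_notMem Ξ hd]

theorem partialSpec_insert (Δ : Set 𝒞) (c : 𝒞) (H : MvPolynomial 𝒞 S) :
    partialSpec Ξ (insert c Δ) H = partialSpec Ξ {c} (partialSpec Ξ Δ H) := by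
  refine DFunLike.congr_fun
    (?_ : partialSpec Ξ (insert c Δ) = (partialSpec Ξ {c}).comp (partialSpec Ξ Δ)) H
  ext1 d
  rw [AlgHom.comp_apply]
  by_cases hd : d ∈ Δ
  · rw [partialSpec_X_mem Ξ hd, partialSpec_X_mem Ξ (Set.mem_insert_of_mem c hd), partialSpec_C]
  · rw [partialSpec_X_notMem Ξ hd]
    by_cases hc : d = c
    · rw [partialSpec_X_mem Ξ (Set.mem_singleton_iff.2 hc),
        partialSpec_X_mem Ξ (Set.mem_insert_iff.2 (Or.inl hc))]
    · rw [partialSpec_X_notMem Ξ (by simp [hc, hd] : d ∉ insert c Δ),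
        partialSpec_X_notMem Ξ (by simpa using hc)]

theorem partialSpec_empty (H : MvPolynomial 𝒞 S) : partialSpec Ξ ∅ H = H := by
  refine DFunLike.congr_fun (?_ : partialSpec Ξ ∅ = AlgHom.id S _) H
  ext1 d
  rw [partialSpec_X_notMem Ξ (Set.notMem_empty d), AlgHom.id_apply]

/-- Setting variables to zero leaves the constant term alone. This is how the final vanishing, known
only after `c = 0` for all `c`, is read as a statement about constant terms. -/
theorem constantCoeff_partialSpec_zero (Δ : Set 𝒞) (H : MvPolynomial 𝒞 S) :
    constantCoeff (partialSpec 0 Δ H) = constantCoeff H := by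
  refine DFunLike.congr_fun
    (?_ : constantCoeff.comp (partialSpec 0 Δ).toRingHom = constantCoeff) H
  refine ringHom_ext (fun r => ?_) fun d => ?_
  · exact congrArg constantCoeff (partialSpec_C 0 Δ r)
  · change constantCoeff (partialSpec 0 Δ (X d)) = constantCoeff (X d)
    by_cases hd : d ∈ Δ
    · rw [partialSpec_X_mem _ hd, constantCoeff_C, constantCoeff_X, Pi.zero_apply]
    · rw [partialSpec_X_notMem _ hd]

theorem exists_eq_C_of_partialSpec_univ {H : MvPolynomial 𝒞 S}
    (h : partialSpec Ξ Set.univ H = H) : ∃ r, H = C r := by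
  refine ⟨aeval Ξ H, h.symm.trans ?_⟩
  refine DFunLike.congr_fun (?_ : partialSpec Ξ Set.univ = (Algebra.ofId S _).comp (aeval Ξ)) H
  ext1 d
  rw [partialSpec_X_mem Ξ (Set.mem_univ d), AlgHom.comp_apply, aeval_X]
  rfl

theorem partialSpec_sub_eq_zero {Δ : Set 𝒞} {c : 𝒞} (hc : c ∈ Δ) :
    partialSpec Ξ Δ (X c - C (Ξ c)) = 0 := by
  rw [map_sub, partialSpec_X_mem Ξ hc, partialSpec_C, sub_self]

theorem partialSpec_sub_of_notMem {Δ : Set 𝒞} {c : 𝒞} (hc : c ∉ Δ) :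
    partialSpec Ξ Δ (X c - C (Ξ c)) = X c - C (Ξ c) := by
  rw [map_sub, partialSpec_X_notMem Ξ hc, partialSpec_C]

/-- The factor theorem: modulo `c - Ξ(c)` the quotient map and its composite with the specialization
agree on every variable. -/
theorem dvd_sub_partialSpec_singleton (c : 𝒞) (H : MvPolynomial 𝒞 S) :
    X c - C (Ξ c) ∣ H - partialSpec Ξ {c} H := by
  rw [← Ideal.mem_span_singleton, ← Ideal.Quotient.mk_eq_mk_iff_sub_mem]
  refine DFunLike.congr_fun (?_ : Ideal.Quotient.mkₐ S (Ideal.span {X c - C (Ξ c)}) =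
    (Ideal.Quotient.mkₐ S (Ideal.span {X c - C (Ξ c)})).comp (partialSpec Ξ {c})) H
  ext1 d
  rw [AlgHom.comp_apply]
  by_cases hd : d = c
  · subst hd
    rw [partialSpec_X_mem Ξ (Set.mem_singleton d)]
    exact Ideal.Quotient.eq.2 (Ideal.mem_span_singleton_self _)
  · rw [partialSpec_X_notMem Ξ (by simpa using hd)]

theorem Round.ne_zero {Ξ : 𝒞 → S} {Δ : Set 𝒞} {c : 𝒞} {H H' : MvPolynomial 𝒞 S}
    (h : Round Ξ Δ c H H') : H' ≠ 0 := by
  rcases h with h | ⟨_, _, _, _, _, h⟩ <;> exact h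

theorem Round.partialSpec_eq {Ξ : 𝒞 → S} {Δ : Set 𝒞} {c : 𝒞} {H H' : MvPolynomial 𝒞 S}
    (h : Round Ξ Δ c H H') : partialSpec Ξ Δ H' = H' := by
  rcases h with h | ⟨_, _, _, _, _, h⟩ <;> exact partialSpec_partialSpec Ξ subset_rfl _

theorem not_exists_infinite_run [Finite 𝒞] :
    ¬ ∃ r : ℕ → State 𝒞 S, ∀ t, Step Ξ (r t) (r (t + 1)) := by
  rintro ⟨r, hr⟩
  have hmono : StrictMono fun t => (r t).Δ := by
    refine strictMono_nat_of_lt_succ fun t => ?_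
    obtain ⟨c, hc, hΔ, -⟩ := hr t
    rw [hΔ]
    exact Set.ssubset_insert hc
  exact not_injective_infinite_finite _ hmono.injective

/-- If homomorphisms `ψ Δ` to a domain are compatible with specialization and do not kill
`c - Ξ(c)` for `c ∉ Δ`, and `ψ ∅` kills the input, then they kill every polynomial handled by the
algorithm. -/
theorem Reachable.apply_eq_zero {N : Type*} [CommRing N] [IsDomain N] [Algebra ℚ S]
    {Ξ : 𝒞 → S} {Q : MvPolynomial 𝒞 ℚ} (ψ : Set 𝒞 → MvPolynomial 𝒞 S →+* N)
    (hψ : ∀ Δ c, c ∉ Δ → ψ Δ (X c - C (Ξ c)) ≠ 0)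
    (hspec : ∀ Δ c H, ψ Δ H = 0 → ψ (insert c Δ) (partialSpec Ξ (insert c Δ) H) = 0)
    (hQ : ψ ∅ (map (algebraMap ℚ S) Q) = 0) {s : State 𝒞 S} (h : Reachable Ξ Q s) :
    ψ s.Δ s.H = 0 := by
  induction h with
  | refl => exact hQ
  | @tail s t _ hst ih =>
    obtain ⟨c, hc, hΔ, hr⟩ := hst
    rw [hΔ] at hr ⊢
    generalize t.H = H' at hr
    cases hr with
    | specialize _ => exact hspec _ _ _ ih
    | divide n A _ _ hA _ =>
      refine hspec _ _ _ ?_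
      rw [hA, map_mul, map_pow] at ih
      exact (mul_eq_zero.1 ih).resolve_left (pow_ne_zero _ (hψ _ _ hc))

/-! ### Existence and uniqueness of a round over a domain -/

variable [IsDomain S]

theorem X_sub_C_ne_zero (c : 𝒞) (r : S) : (X c - C r : MvPolynomial 𝒞 S) ≠ 0 := by
  intro h
  have := congrArg (aeval (fun _ => r + 1)) h
  simp at this

/-- Total degree is additive over a domain and `c - r` has positive degree, so the exponents of its
powers dividing `H` are at most the degree of `H`. -/
theorem finiteMultiplicity_X_sub_C (c : 𝒞) (r : S) {H : MvPolynomial 𝒞 S} (hH : H ≠ 0) :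
    FiniteMultiplicity (X c - C r) H := by
  have hq : (X c - C r : MvPolynomial 𝒞 S).totalDegree ≠ 0 := by
    intro h
    rw [totalDegree_eq_zero_iff_eq_C] at h
    -- A constant would take the same value at `r` and at `r + 1`, but the values are `0` and `1`.
    have h0 := congrArg (aeval (fun _ => r)) h
    have h1 := congrArg (aeval (fun _ => r + 1)) h
    simp only [map_sub, aeval_X, aeval_C, Algebra.algebraMap_self, RingHom.id_apply] at h0 h1
    rw [← h0] at h1
    simp at h1
  refine ⟨H.totalDegree, ?_⟩
  rintro ⟨A, hA⟩
  have hA0 : A ≠ 0 := by rintro rfl; exact hH (by simpa using hA)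
  have hd := congrArg totalDegree hA
  have hpow : ∀ n : ℕ, ((X c - C r : MvPolynomial 𝒞 S) ^ n).totalDegree =
      n * (X c - C r : MvPolynomial 𝒞 S).totalDegree := by
    intro n
    induction n with
    | zero => simp
    | succ n ih =>
      rw [pow_succ, totalDegree_mul_of_isDomain (pow_ne_zero _ (X_sub_C_ne_zero c r))
        (X_sub_C_ne_zero c r), ih, Nat.succ_mul]
  rw [totalDegree_mul_of_isDomain (pow_ne_zero _ (X_sub_C_ne_zero c r)) hA0, hpow] at hd
  nlinarith [Nat.pos_of_ne_zero hq]

/-- The algorithm can process any further indeterminate, with a unique result. -/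
theorem existsUnique_round {Δ : Set 𝒞} {c : 𝒞} (hc : c ∉ Δ) {H : MvPolynomial 𝒞 S} (hH : H ≠ 0)
    (hΔ : partialSpec Ξ Δ H = H) : ∃! H', Round Ξ (insert c Δ) c H H' := by
  by_cases h : partialSpec Ξ (insert c Δ) H = 0
  · have hcm : c ∈ insert c Δ := Set.mem_insert c Δ
    obtain ⟨A, hA, hdvd⟩ := (finiteMultiplicity_X_sub_C c (Ξ c) hH).exists_eq_pow_mul_and_not_dvd
    set s := multiplicity (X c - C (Ξ c)) H
    -- As `c ∉ Δ`, the power of `c - Ξ(c)` is fixed by `Ξ_Δ` and cancels, so the cofactor is free of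
    -- `Δ` too.
    have hfix : partialSpec Ξ Δ A = A := by
      have h1 := hΔ
      rw [hA, map_mul, map_pow, partialSpec_sub_of_notMem Ξ hc] at h1
      exact mul_left_cancel₀ (pow_ne_zero _ (X_sub_C_ne_zero c (Ξ c))) h1
    -- By `hfix` only `c` remains to be specialized in `A`; a zero result would give one more factor
    -- `c - Ξ(c)`, against maximality.
    have hA0 : partialSpec Ξ (insert c Δ) A ≠ 0 := by
      intro h0
      rw [partialSpec_insert, hfix] at h0
      have := dvd_sub_partialSpec_singleton Ξ c A
      rw [h0, sub_zero] at this
      exact hdvd this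
    have hs : 0 < s := by
      rw [Nat.pos_iff_ne_zero]
      intro h0
      rw [h0, pow_zero, one_mul] at hA
      exact hA0 (hA ▸ h)
    -- Any surplus factor `c - Ξ(c)` in `A` would make its specialization zero, so the two exponents
    -- agree.
    have key : ∀ {a b : ℕ} {A B : MvPolynomial 𝒞 S}, a ≤ b →
        (X c - C (Ξ c)) ^ a * A = (X c - C (Ξ c)) ^ b * B →
        partialSpec Ξ (insert c Δ) A ≠ 0 → A = B := by
      intro a b A B hab hAB hne
      obtain ⟨d, rfl⟩ := Nat.exists_eq_add_of_le hab
      rw [pow_add, mul_assoc] at hAB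
      have hAB' := mul_left_cancel₀ (pow_ne_zero _ (X_sub_C_ne_zero c (Ξ c))) hAB
      rcases Nat.eq_zero_or_pos d with rfl | hd
      · simpa using hAB'
      · refine absurd ?_ hne
        rw [hAB', map_mul, map_pow, partialSpec_sub_eq_zero Ξ hcm, zero_pow hd.ne', zero_mul]
    refine ⟨_, Round.divide s A h hs hA hA0, ?_⟩
    rintro H' (h' | ⟨t, B, -, -, hB, hB0⟩)
    · exact absurd h h'
    · rcases le_total s t with hst | hst
      · rw [key hst (hA.symm.trans hB) hA0]
      · rw [key hst (hB.symm.trans hA) hB0]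
  · refine ⟨_, Round.specialize h, ?_⟩
    rintro H' (h' | ⟨t, B, h', -, -, -⟩)
    · rfl
    · exact absurd h' h

variable [Algebra ℚ S]

/-- The polynomials handled by the algorithm are nonzero. -/
theorem Reachable.ne_zero {Ξ : 𝒞 → S} {Q : MvPolynomial 𝒞 ℚ} (hQ : Q ≠ 0) {s : State 𝒞 S}
    (h : Reachable Ξ Q s) : s.H ≠ 0 := by
  rcases h.cases_tail with rfl | ⟨t, -, c, -, -, hr⟩
  · exact (map_ne_zero_iff _ (map_injective _ (algebraMap ℚ S).injective)).2 hQ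
  · exact hr.ne_zero

/-- The polynomials handled by the algorithm are free of the specialized indeterminates. -/
theorem Reachable.partialSpec_eq {Ξ : 𝒞 → S} {Q : MvPolynomial 𝒞 ℚ} {s : State 𝒞 S}
    (h : Reachable Ξ Q s) : partialSpec Ξ s.Δ s.H = s.H := by
  rcases h.cases_tail with rfl | ⟨t, -, c, -, -, hr⟩
  · exact partialSpec_empty Ξ _
  · exact hr.partialSpec_eq

end Algorithm

/-! ### Differential homomorphisms -/

section Hom

variable {R : Type*} [CommRing R] [Differential R] {ι : Type*}
  {A : Type*} [CommRing A] [Differential A]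

/-- The subring of the elements on which a ring homomorphism commutes with the derivations. -/
def diffEqLocus (φ : R →+* A) : Subring R where
  carrier := {x | φ (x′) = (φ x)′}
  zero_mem' := by simp
  one_mem' := by simp
  add_mem' {x y} hx hy := by
    simp only [Set.mem_ofPred_eq] at hx hy ⊢
    rw [map_add, map_add, hx, hy, map_add, map_add]
  neg_mem' {x} hx := by
    simp only [Set.mem_ofPred_eq] at hx ⊢
    rw [map_neg, map_neg, hx, map_neg, map_neg]
  mul_mem' {x y} hx hy := by
    simp only [Set.mem_ofPred_eq] at hx hy ⊢
    rw [Derivation.leibniz, map_add, smul_eq_mul, smul_eq_mul, map_mul, map_mul, hx, hy, map_mul,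
      Derivation.leibniz, smul_eq_mul, smul_eq_mul]

/-- The evaluation homomorphism of differential polynomials at `x`, over `φ`. -/
def diffEval (φ : R →+* A) (x : ι → A) : DiffPoly R ι →+* A :=
  MvPolynomial.eval₂Hom φ fun v => (fun a : A => a′)^[v.2] (x v.1)

theorem diffEval_C (φ : R →+* A) (x : ι → A) (r : R) :
    diffEval φ x (MvPolynomial.C r) = φ r :=
  MvPolynomial.eval₂Hom_C _ _ _

theorem diffEval_X (φ : R →+* A) (x : ι → A) (v : ι × ℕ) :
    diffEval φ x (MvPolynomial.X v) = (fun a : A => a′)^[v.2] (x v.1) :=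
  MvPolynomial.eval₂Hom_X' _ _ _

/-- The elements on which the map commutes with the derivations form a subring, so coefficients and
variables suffice. -/
theorem diffEval_deriv (φ : R →+* A) (hφ : ∀ r, φ (r′) = (φ r)′) (x : ι → A)
    (p : DiffPoly R ι) : diffEval φ x (p′) = (diffEval φ x p)′ := by
  change p ∈ diffEqLocus (diffEval φ x)
  induction p using MvPolynomial.induction_on with
  | C r =>
    change diffEval φ x ((MvPolynomial.C r)′) = ((diffEval φ x (MvPolynomial.C r))′)
    rw [diffPoly_deriv_C, diffEval_C, diffEval_C, hφ]
  | add p q hp hq => exact add_mem hp hq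
  | mul_X p v hp =>
    refine mul_mem hp ?_
    change diffEval φ x ((MvPolynomial.X v)′) = ((diffEval φ x (MvPolynomial.X v))′)
    obtain ⟨i, k⟩ := v
    rw [diffPoly_deriv_X, diffEval_X, diffEval_X, Function.iterate_succ_apply']

theorem iterate_deriv_map (φ : R →+* A) (hφ : ∀ r, φ (r′) = (φ r)′) (k : ℕ) (r : R) :
    φ ((fun a : R => a′)^[k] r) = (fun a : A => a′)^[k] (φ r) := by
  induction k with
  | zero => rfl
  | succ k ih => rw [Function.iterate_succ_apply', Function.iterate_succ_apply', hφ, ih]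

theorem diffPoly_iterate_deriv_X (i : ι) (k : ℕ) :
    (fun a : DiffPoly R ι => a′)^[k] (MvPolynomial.X (i, 0)) = MvPolynomial.X (i, k) := by
  induction k with
  | zero => rfl
  | succ k ih => rw [Function.iterate_succ_apply', ih, diffPoly_deriv_X]

/-! ### Closure properties of differential ideals -/

theorem subset_diffIdeal (T : Set A) : T ⊆ diffIdeal T := fun _ hx =>
  Submodule.mem_sInf.2 fun _ hI => hI.1 hx

theorem deriv_mem_diffIdeal {T : Set A} {x : A} (hx : x ∈ diffIdeal T) : x′ ∈ diffIdeal T :=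
  Submodule.mem_sInf.2 fun I hI => hI.2 x (Submodule.mem_sInf.1 hx I hI)

theorem iterate_deriv_mem_diffIdeal {T : Set A} {x : A} (hx : x ∈ diffIdeal T) (k : ℕ) :
    (fun a : A => a′)^[k] x ∈ diffIdeal T := by
  induction k with
  | zero => exact hx
  | succ k ih => rw [Function.iterate_succ_apply']; exact deriv_mem_diffIdeal ih

/-! ### Laurent differential polynomials -/

theorem single_zero_deriv (r : R) :
    (AddMonoidAlgebra.single 0 r : LaurentDiffPoly R ι)′ = AddMonoidAlgebra.single 0 (r′) := by
  rw [laurent_deriv_single]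
  simp [logDeriv]

theorem single_one_deriv (α : (ι × ℕ) →₀ ℤ) :
    (AddMonoidAlgebra.single α 1 : LaurentDiffPoly R ι)′ =
      AddMonoidAlgebra.single α 1 * logDeriv R ι α := by
  rw [laurent_deriv_single]
  simp

theorem mapRingHom_logDeriv {R' : Type*} [CommRing R'] (φ : R →+* R') (α : (ι × ℕ) →₀ ℤ) :
    AddMonoidAlgebra.mapRingHom _ φ (logDeriv R ι α) = logDeriv R' ι α := by
  simp [logDeriv, Finsupp.sum, map_sum]

/-- A homomorphism of differential rings extends to Laurent differential polynomials as soon as it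
is compatible with the derivation on coefficients and on monomials. -/
theorem laurent_map_deriv (φ : LaurentDiffPoly R ι →+* A)
    (h0 : ∀ r : R, φ (AddMonoidAlgebra.single 0 (r′)) = (φ (AddMonoidAlgebra.single 0 r))′)
    (h1 : ∀ α, φ (AddMonoidAlgebra.single α 1 * logDeriv R ι α) =
      (φ (AddMonoidAlgebra.single α 1))′)
    (g : LaurentDiffPoly R ι) : φ (g′) = (φ g)′ := by
  change g ∈ diffEqLocus φ
  induction g using AddMonoidAlgebra.induction_linear with
  | zero => exact zero_mem _
  | add x y hx hy => exact add_mem hx hy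
  | single α r =>
    have h : (AddMonoidAlgebra.single α r : LaurentDiffPoly R ι) =
        AddMonoidAlgebra.single 0 r * AddMonoidAlgebra.single α 1 := by
      simp [AddMonoidAlgebra.single_mul_single]
    rw [h]
    refine mul_mem ?_ ?_
    · change φ ((AddMonoidAlgebra.single 0 r)′) = _
      rw [single_zero_deriv, h0]
    · change φ ((AddMonoidAlgebra.single α 1)′) = _
      rw [single_one_deriv, h1]

theorem mapRingHom_deriv {R' : Type*} [CommRing R'] [Differential R'] (φ : R →+* R')
    (hφ : ∀ r, φ (r′) = (φ r)′) (g : LaurentDiffPoly R ι) :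
    AddMonoidAlgebra.mapRingHom _ φ (g′) =
      (AddMonoidAlgebra.mapRingHom ((ι × ℕ) →₀ ℤ) φ g)′ := by
  refine laurent_map_deriv _ (fun r => ?_) (fun α => ?_) g
  · simp only [AddMonoidAlgebra.mapRingHom_single, single_zero_deriv, hφ]
  · rw [map_mul, mapRingHom_logDeriv, AddMonoidAlgebra.mapRingHom_single, map_one,
      single_one_deriv]

/-- The Laurent differential polynomials in the variables of `V`. -/
def suppSubring (R : Type*) [CommRing R] (V : Set (ι × ℕ)) : Subring (LaurentDiffPoly R ι) where
  carrier := {g | ∀ α ∈ g.coeff.support, ∀ v ∈ α.support, v ∈ V}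
  zero_mem' := by simp
  one_mem' := by
    intro α hα
    have := Finsupp.support_single_subset hα
    simp only [Finset.mem_singleton] at this
    simp [this]
  add_mem' {x y} hx hy := by
    classical
    intro α hα
    rcases Finset.mem_union.1 (Finsupp.support_add hα) with h | h
    exacts [hx α h, hy α h]
  neg_mem' {x} hx := by
    intro α hα
    refine hx α ?_
    simpa using hα
  mul_mem' {x y} hx hy := by
    classical
    intro α hα v hv
    obtain ⟨β, hβ, δ, hδ, rfl⟩ := Finset.mem_add.1 (AddMonoidAlgebra.support_coeff_mul_subset x y hα)
    rcases Finset.mem_union.1 (Finsupp.support_add hv) with h | h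
    exacts [hx β hβ v h, hy δ hδ v h]

theorem single_mem_suppSubring {V : Set (ι × ℕ)} {α : (ι × ℕ) →₀ ℤ}
    (hα : ∀ v ∈ α.support, v ∈ V) (r : R) :
    (AddMonoidAlgebra.single α r : LaurentDiffPoly R ι) ∈ suppSubring R V := by
  intro β hβ
  have := Finsupp.support_single_subset hβ
  rw [Finset.mem_singleton] at this
  rwa [this]

theorem deriv_mem_suppSubring {V V' : Set (ι × ℕ)} (hV : V ⊆ V')
    (hs : ∀ v ∈ V, (v.1, v.2 + 1) ∈ V') {g : LaurentDiffPoly R ι} (hg : g ∈ suppSubring R V) :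
    g′ ∈ suppSubring R V' := by
  classical
  rw [← AddMonoidAlgebra.sum_coeff_single g, Finsupp.sum, map_sum]
  refine sum_mem fun α hα => ?_
  have hα' : ∀ v ∈ α.support, v ∈ V := hg α hα
  rw [laurent_deriv_single]
  have h : ∀ r : R, (AddMonoidAlgebra.single α r : LaurentDiffPoly R ι) ∈ suppSubring R V' :=
    single_mem_suppSubring fun v hv => hV (hα' v hv)
  refine add_mem (h _) (mul_mem (h _) (sum_mem fun v hv => single_mem_suppSubring ?_ _))
  intro w hw
  rcases Finset.mem_union.1 (Finsupp.support_sub hw) with hw | hw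
  · rw [Finset.mem_singleton.1 (Finsupp.support_single_subset hw)]
    exact hs v (hα' v hv)
  · rw [Finset.mem_singleton.1 (Finsupp.support_single_subset hw)]
    exact hV (hα' v hv)

end Hom

/-! ### The prolonged system -/

section System

variable {R : Type*} [CommRing R] [Differential R] {m : ℕ}
  (F : Fin (m + 1) → LaurentDiffPoly R (Fin m))

instance finite_psIdx : Finite (PsIdx F) := by
  obtain ⟨N, hN⟩ : ∃ N : ℕ, ∀ i, jacobi F i ≤ (N : WithBot ℕ) := by
    -- A Jacobi number `-∞` is replaced by `0`, which is harmless for an upper bound.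
    refine ⟨Finset.univ.sup fun i => (jacobi F i).unbotD 0, fun i => ?_⟩
    refine (WithBot.le_coe_unbotD _ 0).trans (WithBot.coe_le_coe.2 ?_)
    exact Finset.le_sup (f := fun i => (jacobi F i).unbotD 0) (Finset.mem_univ i)
  refine Set.Finite.to_subtype (s := {p : Fin (m + 1) × ℕ |
    ((p.2 + gamma F : ℕ) : WithBot ℕ) ≤ jacobi F p.1}) ?_
  refine ((Set.finite_univ (α := Fin (m + 1))).prod (Set.finite_Iic N)).subset ?_
  rintro ⟨i, k⟩ h
  refine ⟨Set.mem_univ _, ?_⟩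
  have := WithBot.coe_le_coe.1 (le_trans h (hN i))
  exact (Nat.le_add_right _ _).trans this

instance finite_cIdx : Finite (CIdx F) :=
  inferInstanceAs (Finite (Σ l : PsIdx F, {α : VarIdx F →₀ ℤ // α ∈ algSupport F (ps F l)}))

/-- Differentiating `u^α` introduces only successors of variables already present: the upper bound
grows by one and the lower bound `γ_j` persists. -/
theorem iterate_deriv_mem_suppSubring (i : Fin (m + 1)) (k : ℕ) :
    (fun g : LaurentDiffPoly R (Fin m) => g′)^[k] (F i) ∈ suppSubring R
      {v : Fin m × ℕ | gammaAt F v.1 ≤ v.2 ∧ (v.2 : WithBot ℕ) ≤ ord (F i) v.1 + k} := by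
  induction k with
  | zero =>
    intro α hα v hv
    have hmem : v.2 ∈ diffSupport (F i) v.1 := by
      simp only [diffSupport, Finset.mem_image, Finset.mem_filter, Finset.mem_biUnion]
      exact ⟨v, ⟨⟨α, hα, hv⟩, rfl⟩, rfl⟩
    refine ⟨Nat.sInf_le ⟨i, hmem⟩, ?_⟩
    rw [Nat.cast_zero, add_zero]
    exact Finset.le_max hmem
  | succ k ih =>
    rw [Function.iterate_succ_apply']
    refine deriv_mem_suppSubring ?_ ?_ ih
    · rintro v ⟨h1, h2⟩
      refine ⟨h1, h2.trans ?_⟩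
      gcongr
      exact Nat.le_succ k
    · rintro v ⟨h1, h2⟩
      refine ⟨h1.trans (Nat.le_succ _), ?_⟩
      push_cast
      rw [← add_assoc]
      gcongr

theorem ps_mem_suppSubring (l : PsIdx F) : ps F l ∈ suppSubring R
    {v : Fin m × ℕ | gammaAt F v.1 ≤ v.2 ∧
      ((v.2 + gamma F : ℕ) : WithBot ℕ) ≤ Finset.univ.sup fun i => ord (F i) v.1 + jacobi F i} := by
  intro α hα v hv
  obtain ⟨h1, h2⟩ := iterate_deriv_mem_suppSubring F l.1.1 l.1.2 α hα v hv
  refine ⟨h1, le_trans ?_ (Finset.le_sup (f := fun i => ord (F i) v.1 + jacobi F i)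
    (Finset.mem_univ l.1.1))⟩
  calc ((v.2 + gamma F : ℕ) : WithBot ℕ) = (v.2 : WithBot ℕ) + (gamma F : ℕ) := by push_cast; rfl
    _ ≤ ord (F l.1.1) v.1 + (l.1.2 : WithBot ℕ) + (gamma F : ℕ) := by gcongr
    _ = ord (F l.1.1) v.1 + ((l.1.2 + gamma F : ℕ) : WithBot ℕ) := by push_cast; rw [add_assoc]
    _ ≤ _ := by gcongr; exact l.2

/-- The elements of `ps(𝒫)` are Laurent polynomials in the variables `𝒱(𝒫)`. -/
theorem exists_liftExp_eq (l : PsIdx F) {β : (Fin m × ℕ) →₀ ℤ}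
    (hβ : β ∈ (ps F l).coeff.support) : ∃ α, liftExp F α = β := by
  have h := ps_mem_suppSubring F l β hβ
  refine ⟨β.comapDomain (Subtype.val : VarIdx F → Fin m × ℕ) Subtype.val_injective.injOn, ?_⟩
  exact Finsupp.embDomain_comapDomain fun v hv => ⟨⟨v, h v hv⟩, rfl⟩

/-- Since every exponent of `ps` lies in the range of `liftExp`, restricting to `algSupport` loses
no term. -/
theorem sum_single_Xi (l : PsIdx F) :
    ∑ α ∈ (algSupport F (ps F l)).attach,
      (AddMonoidAlgebra.single (liftExp F α.1) (Xi F ⟨l, α⟩) : LaurentDiffPoly R (Fin m)) =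
    ps F l := by
  conv_rhs => rw [← AddMonoidAlgebra.sum_coeff_single (ps F l), Finsupp.sum]
  refine Finset.sum_bij (fun α _ => liftExp F α.1) ?_ ?_ ?_ ?_
  · exact fun α _ => Finset.mem_preimage.1 α.2
  · exact fun α _ β _ h => Subtype.ext (Finsupp.embDomain_injective _ h)
  · intro β hβ
    obtain ⟨α, rfl⟩ := exists_liftExp_eq F l hβ
    exact ⟨⟨α, Finset.mem_preimage.2 hβ⟩, Finset.mem_attach _ _, rfl⟩
  · exact fun α _ => rfl

/-! ### Elimination of the generic coefficients -/

section Elim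

variable (f : Fin (m + 1) → LaurentDiffPoly R (Fin m)) (M : Fin (m + 1) → ((Fin m × ℕ) →₀ ℤ))

/-- The remainder has coefficients in `𝒟`, free of every `𝔞_i`; this is what makes `F_i = b_i`
solvable. -/
theorem tildeSystem_eq (i : Fin (m + 1)) :
    tildeSystem f M i = AddMonoidAlgebra.single (M i) (MvPolynomial.X (i, 0)) +
      AddMonoidAlgebra.mapRingHom _ MvPolynomial.C ((f i).erase (M i)) := by
  classical
  ext α
  by_cases h : α = M i
  · subst h
    simp [tildeSystem]
  · simp [tildeSystem, h, Finsupp.update_apply]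

/-- The differential homomorphism `𝒟̃ → 𝒟{U^±}{b_1, …, b_n}` that solves `F_i = b_i` for the
generic coefficient `𝔞_i`. -/
def elimCoeff : DiffPoly R (Fin (m + 1)) →+*
    DiffPoly (LaurentDiffPoly R (Fin m)) (Fin (m + 1)) :=
  diffEval (MvPolynomial.C.comp AddMonoidAlgebra.singleZeroRingHom) fun i =>
    MvPolynomial.C (AddMonoidAlgebra.single (-M i) 1) *
      (MvPolynomial.X (i, 0) - MvPolynomial.C ((f i).erase (M i)))

theorem elimCoeff_deriv (p : DiffPoly R (Fin (m + 1))) :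
    elimCoeff f M (p′) = (elimCoeff f M p)′ := by
  refine diffEval_deriv _ (fun r => ?_) _ p
  rw [RingHom.comp_apply, RingHom.comp_apply, diffPoly_deriv_C]
  exact congrArg MvPolynomial.C (single_zero_deriv r).symm

/-- The extension of `elimCoeff` to `𝒟̃{U^±}`. -/
def elimHom : LaurentDiffPoly (DiffPoly R (Fin (m + 1))) (Fin m) →+*
    DiffPoly (LaurentDiffPoly R (Fin m)) (Fin (m + 1)) :=
  AddMonoidAlgebra.liftNCRingHom (elimCoeff f M)
    ((MvPolynomial.C : LaurentDiffPoly R (Fin m) →+* _).toMonoidHom.comp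
      (AddMonoidAlgebra.of R _)) fun _ _ => Commute.all _ _

theorem elimHom_single (α : (Fin m × ℕ) →₀ ℤ) (p : DiffPoly R (Fin (m + 1))) :
    elimHom f M (AddMonoidAlgebra.single α p) =
      elimCoeff f M p * MvPolynomial.C (AddMonoidAlgebra.single α 1) :=
  AddMonoidAlgebra.liftNCRingHom_single _ _ _ _ _

theorem elimHom_map (g : LaurentDiffPoly R (Fin m)) :
    elimHom f M (AddMonoidAlgebra.mapRingHom _ MvPolynomial.C g) = MvPolynomial.C g := by
  refine DFunLike.congr_fun (?_ : (elimHom f M).comp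
    (AddMonoidAlgebra.mapRingHom _ MvPolynomial.C) = MvPolynomial.C) g
  refine AddMonoidAlgebra.ringHom_ext (fun r => ?_) fun α => ?_
  · rw [RingHom.comp_apply, AddMonoidAlgebra.mapRingHom_single, elimHom_single, elimCoeff,
      diffEval_C, ← AddMonoidAlgebra.one_def, map_one, mul_one]
    rfl
  · rw [RingHom.comp_apply, AddMonoidAlgebra.mapRingHom_single, elimHom_single, map_one, map_one,
      one_mul]

theorem elimHom_deriv (g : LaurentDiffPoly (DiffPoly R (Fin (m + 1))) (Fin m)) :
    elimHom f M (g′) = (elimHom f M g)′ := by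
  refine laurent_map_deriv _ (fun p => ?_) (fun α => ?_) g
  · rw [elimHom_single, elimHom_single, ← AddMonoidAlgebra.one_def, map_one, mul_one, mul_one,
      elimCoeff_deriv]
  · have h1 : (AddMonoidAlgebra.single α 1 : LaurentDiffPoly (DiffPoly R (Fin (m + 1))) (Fin m)) =
        AddMonoidAlgebra.mapRingHom _ MvPolynomial.C (AddMonoidAlgebra.single α (1 : R)) := by
      rw [AddMonoidAlgebra.mapRingHom_single, map_one]
    rw [map_mul, ← mapRingHom_logDeriv MvPolynomial.C, h1, elimHom_map, elimHom_map,
      diffPoly_deriv_C, single_one_deriv, map_mul]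

theorem single_mul_single_neg (α : (Fin m × ℕ) →₀ ℤ) :
    (AddMonoidAlgebra.single α 1 * AddMonoidAlgebra.single (-α) 1 :
      LaurentDiffPoly R (Fin m)) = 1 := by
  rw [AddMonoidAlgebra.single_mul_single, add_neg_cancel, one_mul, AddMonoidAlgebra.one_def]

theorem elimHom_tildeSystem (i : Fin (m + 1)) :
    elimHom f M (tildeSystem f M i) = MvPolynomial.X (i, 0) := by
  rw [tildeSystem_eq, map_add, elimHom_map, elimHom_single, elimCoeff, diffEval_X,
    Function.iterate_zero, id, mul_right_comm, ← MvPolynomial.C_mul,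
    mul_comm (AddMonoidAlgebra.single _ _), single_mul_single_neg, map_one, one_mul,
    sub_add_cancel]

/-- Compatibility with the derivations turns the prolonged system into distinct independent
variables. -/
theorem elimHom_ps (l : PsIdx (tildeSystem f M)) :
    elimHom f M (ps (tildeSystem f M) l) = MvPolynomial.X l.1 := by
  rw [ps, iterate_deriv_map _ (elimHom_deriv f M), elimHom_tildeSystem,
    diffPoly_iterate_deriv_X]

/-- The differential homomorphism `𝒟{U^±}{b_1, …, b_n} → 𝒟̃{U^±}` that maps `b_i` to `F_i`. -/
def evalSystem : DiffPoly (LaurentDiffPoly R (Fin m)) (Fin (m + 1)) →+*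
    LaurentDiffPoly (DiffPoly R (Fin (m + 1))) (Fin m) :=
  diffEval (AddMonoidAlgebra.mapRingHom _ MvPolynomial.C) (tildeSystem f M)

theorem evalSystem_deriv (p : DiffPoly (LaurentDiffPoly R (Fin m)) (Fin (m + 1))) :
    evalSystem f M (p′) = (evalSystem f M p)′ :=
  diffEval_deriv _ (mapRingHom_deriv _ fun r => (diffPoly_deriv_C _ _ r).symm) _ p

/-- Solving for `𝔞_i` and then putting `b_i = F_i` returns `𝔞_i`. Both maps are differential, so the
case of order zero gives all derivatives. -/
theorem evalSystem_elimCoeff (p : DiffPoly R (Fin (m + 1))) :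
    evalSystem f M (elimCoeff f M p) = AddMonoidAlgebra.single 0 p := by
  refine DFunLike.congr_fun (?_ : (evalSystem f M).comp (elimCoeff f M) =
    AddMonoidAlgebra.singleZeroRingHom) p
  refine MvPolynomial.ringHom_ext (fun r => ?_) fun v => ?_
  · rw [RingHom.comp_apply, elimCoeff, diffEval_C, evalSystem, RingHom.comp_apply, diffEval_C]
    simp
  · obtain ⟨i, k⟩ := v
    have hz : evalSystem f M (elimCoeff f M (MvPolynomial.X (i, 0))) =
        AddMonoidAlgebra.single 0 (MvPolynomial.X (i, 0)) := by
      rw [elimCoeff, diffEval_X, Function.iterate_zero, id, map_mul, map_sub, evalSystem,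
        diffEval_C, diffEval_C, diffEval_X, Function.iterate_zero, id, tildeSystem_eq,
        add_sub_cancel_right, AddMonoidAlgebra.mapRingHom_single,
        AddMonoidAlgebra.single_mul_single, neg_add_cancel, map_one, one_mul]
    rw [RingHom.comp_apply, ← diffPoly_iterate_deriv_X, iterate_deriv_map _ (elimCoeff_deriv f M),
      iterate_deriv_map _ (evalSystem_deriv f M), hz, diffPoly_iterate_deriv_X]
    induction k with
    | zero => rfl
    | succ k ih =>
      rw [Function.iterate_succ_apply', ih, ← diffPoly_deriv_X]
      exact single_zero_deriv _

/-- Each `b_{i,k}` goes to `∂^k F_i`, which is zero modulo the differential ideal; only the constant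
term is left. -/
theorem evalSystem_sub_mem (p : DiffPoly (LaurentDiffPoly R (Fin m)) (Fin (m + 1))) :
    evalSystem f M p - evalSystem f M (MvPolynomial.C (MvPolynomial.constantCoeff p)) ∈
      diffIdeal (Set.range (tildeSystem f M)) := by
  rw [← Ideal.Quotient.mk_eq_mk_iff_sub_mem]
  refine DFunLike.congr_fun (?_ : (Ideal.Quotient.mk _).comp (evalSystem f M) =
    ((Ideal.Quotient.mk _).comp (evalSystem f M)).comp
      (MvPolynomial.C.comp MvPolynomial.constantCoeff)) p
  refine MvPolynomial.ringHom_ext (fun r => ?_) fun v => ?_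
  · simp
  · simp only [RingHom.comp_apply, MvPolynomial.constantCoeff_X, map_zero]
    rw [Ideal.Quotient.eq_zero_iff_mem, evalSystem, diffEval_X]
    exact iterate_deriv_mem_diffIdeal (subset_diffIdeal _ (Set.mem_range_self v.1)) _

/-- An element of `𝒟̃` that vanishes modulo `F_i = 0` lies in `[𝒫̃]`. -/
theorem mem_diffIdeal_of_constantCoeff_eq_zero {h : DiffPoly R (Fin (m + 1))}
    (hh : MvPolynomial.constantCoeff (elimCoeff f M h) = 0) :
    algebraMap (DiffPoly R (Fin (m + 1))) (LaurentDiffPoly (DiffPoly R (Fin (m + 1))) (Fin m)) h ∈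
      diffIdeal (Set.range (tildeSystem f M)) := by
  have := evalSystem_sub_mem f M (elimCoeff f M h)
  rwa [hh, map_zero, map_zero, sub_zero, evalSystem_elimCoeff] at this

/-! ### The generic point of the algebraic generic system -/

/-- The homomorphism `𝒟{U^±}{b_1, …, b_n} → 𝒟{U^±}[𝒞]` that maps `b_{i,k} = ∂^k F_i` to
`- ∑_α c_α υ(y^α)` if `∂^k F_i` belongs to `ps`, and to zero otherwise. -/
def psHom : DiffPoly (LaurentDiffPoly R (Fin m)) (Fin (m + 1)) →+*
    MvPolynomial (CIdx (tildeSystem f M)) (LaurentDiffPoly R (Fin m)) :=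
  open Classical in
  MvPolynomial.eval₂Hom MvPolynomial.C fun p =>
    if h : ((p.2 + gamma (tildeSystem f M) : ℕ) : WithBot ℕ) ≤ jacobi (tildeSystem f M) p.1 then
      -∑ α ∈ (algSupport (tildeSystem f M) (ps (tildeSystem f M) ⟨p, h⟩)).attach,
        MvPolynomial.X ⟨⟨p, h⟩, α⟩ *
          MvPolynomial.C (AddMonoidAlgebra.single (liftExp (tildeSystem f M) α.1) 1)
    else 0

theorem psHom_C (g : LaurentDiffPoly R (Fin m)) :
    psHom f M (MvPolynomial.C g) = MvPolynomial.C g :=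
  MvPolynomial.eval₂Hom_C _ _ _

theorem psHom_X (l : PsIdx (tildeSystem f M)) :
    psHom f M (MvPolynomial.X l.1) =
      -∑ α ∈ (algSupport (tildeSystem f M) (ps (tildeSystem f M) l)).attach,
        MvPolynomial.X ⟨l, α⟩ *
          MvPolynomial.C (AddMonoidAlgebra.single (liftExp (tildeSystem f M) α.1) 1) := by
  rw [psHom, MvPolynomial.eval₂Hom_X']
  exact dif_pos l.2

/-- Each `b_{i,k}` goes to a linear form in the `c` or to zero, so no constant term is created. -/
theorem constantCoeff_psHom (p : DiffPoly (LaurentDiffPoly R (Fin m)) (Fin (m + 1))) :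
    MvPolynomial.constantCoeff (psHom f M p) = MvPolynomial.constantCoeff p := by
  refine DFunLike.congr_fun
    (?_ : MvPolynomial.constantCoeff.comp (psHom f M) = MvPolynomial.constantCoeff) p
  refine MvPolynomial.ringHom_ext (fun r => ?_) fun v => ?_
  · rw [RingHom.comp_apply, psHom_C, MvPolynomial.constantCoeff_C, MvPolynomial.constantCoeff_C]
  · rw [RingHom.comp_apply, psHom, MvPolynomial.eval₂Hom_X']
    split_ifs with h
    · rw [map_neg, map_sum, MvPolynomial.constantCoeff_X, neg_eq_zero]
      refine Finset.sum_eq_zero fun α _ => ?_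
      rw [map_mul]
      exact (congrArg (· * _) (MvPolynomial.constantCoeff_X _ _)).trans (zero_mul _)
    · rw [map_zero, MvPolynomial.constantCoeff_X]

/-- The generic point of the algebraic generic system: it maps `c` to `c + Ξ(c)`, where `𝔞_i` is
determined by `∂^k F_i = - ∑_α c_α υ(y^α)`. -/
def genericPoint : MvPolynomial (CIdx (tildeSystem f M)) (DiffPoly R (Fin (m + 1))) →+*
    MvPolynomial (CIdx (tildeSystem f M)) (LaurentDiffPoly R (Fin m)) :=
  MvPolynomial.eval₂Hom ((psHom f M).comp (elimCoeff f M)) fun c =>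
    MvPolynomial.X c + psHom f M (elimCoeff f M (Xi (tildeSystem f M) c))

theorem genericPoint_C (p : DiffPoly R (Fin (m + 1))) :
    genericPoint f M (MvPolynomial.C p) = psHom f M (elimCoeff f M p) :=
  MvPolynomial.eval₂Hom_C _ _ _

theorem genericPoint_X (c : CIdx (tildeSystem f M)) :
    genericPoint f M (MvPolynomial.X c) =
      MvPolynomial.X c + psHom f M (elimCoeff f M (Xi (tildeSystem f M) c)) :=
  MvPolynomial.eval₂Hom_X' _ _ _

theorem genericPoint_sub (c : CIdx (tildeSystem f M)) :
    genericPoint f M (MvPolynomial.X c - MvPolynomial.C (Xi (tildeSystem f M) c)) =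
      MvPolynomial.X c := by
  rw [map_sub, genericPoint_C, genericPoint_X, add_sub_cancel_right]

/-- For `c ∈ Δ` the images `c + Ξ(c)` and `Ξ(c)` differ by `c`, which is then set to zero. -/
theorem genericPoint_partialSpec (Δ : Set (CIdx (tildeSystem f M)))
    (H : MvPolynomial (CIdx (tildeSystem f M)) (DiffPoly R (Fin (m + 1)))) :
    partialSpec 0 Δ (genericPoint f M (partialSpec (Xi (tildeSystem f M)) Δ H)) =
      partialSpec 0 Δ (genericPoint f M H) := by
  have h : ∀ c, partialSpec 0 Δ (genericPoint f M (partialSpec (Xi (tildeSystem f M)) Δ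
      (MvPolynomial.X c))) = partialSpec 0 Δ (genericPoint f M (MvPolynomial.X c)) := by
    intro c
    by_cases hc : c ∈ Δ
    · rw [partialSpec_X_mem _ hc, genericPoint_C, genericPoint_X, map_add, partialSpec_X_mem _ hc,
        Pi.zero_apply, map_zero, zero_add]
    · rw [partialSpec_X_notMem _ hc]
  induction H using MvPolynomial.induction_on with
  | C r => rw [partialSpec_C]
  | add p q hp hq => simp only [map_add, hp, hq]
  | mul_X p c hp => simp only [map_mul, hp, h]

variable [Algebra ℚ R]

/-- The extension of `genericPoint` to `ℚ[𝒞][𝒴^±]`. -/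
def genericPointLaurent : GenericRing (tildeSystem f M) →+*
    MvPolynomial (CIdx (tildeSystem f M)) (LaurentDiffPoly R (Fin m)) :=
  AddMonoidAlgebra.liftNCRingHom
    ((genericPoint f M).comp (MvPolynomial.map (algebraMap ℚ (DiffPoly R (Fin (m + 1))))))
    ((MvPolynomial.C : LaurentDiffPoly R (Fin m) →+* _).toMonoidHom.comp
      ((AddMonoidAlgebra.of R _).comp (AddMonoidHom.toMultiplicative
        (Finsupp.embDomain.addMonoidHom (Function.Embedding.subtype _)))))
    fun _ _ => Commute.all _ _

theorem genericPointLaurent_single (α : VarIdx (tildeSystem f M) →₀ ℤ)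
    (p : MvPolynomial (CIdx (tildeSystem f M)) ℚ) :
    genericPointLaurent f M (AddMonoidAlgebra.single α p) =
      genericPoint f M (MvPolynomial.map (algebraMap ℚ _) p) *
        MvPolynomial.C (AddMonoidAlgebra.single (liftExp (tildeSystem f M) α) 1) :=
  AddMonoidAlgebra.liftNCRingHom_single _ _ _ _ _

theorem genericPointLaurent_ags (l : PsIdx (tildeSystem f M)) :
    genericPointLaurent f M (ags (tildeSystem f M) l) = 0 := by
  -- The same element of `ps` is read twice: expanded with the coefficients `Ξ(c)`, and as the
  -- variable `b_{i,k}`.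
  have h : psHom f M (elimHom f M (∑ α ∈ (algSupport (tildeSystem f M)
      (ps (tildeSystem f M) l)).attach, AddMonoidAlgebra.single (liftExp (tildeSystem f M) α.1)
        (Xi (tildeSystem f M) ⟨l, α⟩))) = psHom f M (MvPolynomial.X l.1) := by
    rw [sum_single_Xi, elimHom_ps]
  rw [psHom_X, map_sum, map_sum] at h
  simp only [elimHom_single, map_mul, psHom_C] at h
  have hX : ∀ c, genericPoint f M (MvPolynomial.map (algebraMap ℚ _) (MvPolynomial.X c)) =
      MvPolynomial.X c + psHom f M (elimCoeff f M (Xi (tildeSystem f M) c)) := fun c => by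
    rw [MvPolynomial.map_X, genericPoint_X]
  rw [ags, map_sum]
  -- The factor `c + Ξ(c)` splits the sum in two; by `h` the part with `Ξ(c)` is the negative of the
  -- part with `c`.
  refine (Finset.sum_congr rfl fun α _ => ?_).trans
    (Finset.sum_add_distrib.trans ((congrArg _ h).trans (add_neg_cancel _)))
  exact (genericPointLaurent_single f M _ _).trans
    ((congrArg (· * _) (hX ⟨l, α⟩)).trans (add_mul _ _ _))

theorem genericPoint_eq_zero {Q : MvPolynomial (CIdx (tildeSystem f M)) ℚ}
    (hQ : Q ∈ elimIdeal (tildeSystem f M)) :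
    genericPoint f M (MvPolynomial.map (algebraMap ℚ _) Q) = 0 := by
  have hle : Ideal.span (Set.range (ags (tildeSystem f M))) ≤
      RingHom.ker (genericPointLaurent f M) := by
    rw [Ideal.span_le]
    rintro _ ⟨l, rfl⟩
    exact genericPointLaurent_ags f M l
  have h : genericPointLaurent f M (AddMonoidAlgebra.single 0 Q) = 0 := hle hQ
  have h0 : liftExp (tildeSystem f M) 0 = 0 := Finsupp.embDomain_zero _
  rwa [genericPointLaurent_single, h0, ← AddMonoidAlgebra.one_def, map_one, mul_one] at h

theorem reachable_genericPoint_eq_zero [IsDomain R]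
    {Q : MvPolynomial (CIdx (tildeSystem f M)) ℚ} (hQ : Q ∈ elimIdeal (tildeSystem f M))
    {s : State (CIdx (tildeSystem f M)) (DiffPoly R (Fin (m + 1)))}
    (hs : Reachable (Xi (tildeSystem f M)) Q s) :
    partialSpec 0 s.Δ (genericPoint f M s.H) = 0 := by
  -- The homomorphism attached to `Δ` is the generic point followed by `c = 0` for `c ∈ Δ`.
  refine Reachable.apply_eq_zero (fun Δ => RingHom.comp
    (partialSpec (0 : CIdx (tildeSystem f M) → LaurentDiffPoly R (Fin m)) Δ).toRingHom
    (genericPoint f M)) (fun Δ c hc => ?_) (fun Δ c H hH => ?_) ?_ hs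
  · change partialSpec 0 Δ (genericPoint f M _) ≠ 0
    rw [genericPoint_sub, partialSpec_X_notMem _ hc]
    exact MvPolynomial.X_ne_zero c
  · change partialSpec 0 Δ (genericPoint f M H) = 0 at hH
    change partialSpec 0 (insert c Δ) (genericPoint f M _) = 0
    rw [genericPoint_partialSpec, partialSpec_insert, hH, map_zero]
  · change partialSpec 0 ∅ (genericPoint f M _) = 0
    rw [partialSpec_empty, genericPoint_eq_zero f M hQ]

theorem mem_diffIdeal_of_isOutput [IsDomain R]
    {Q : MvPolynomial (CIdx (tildeSystem f M)) ℚ} (hQ : Q ∈ elimIdeal (tildeSystem f M))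
    {h : DiffPoly R (Fin (m + 1))} (hh : IsOutput (Xi (tildeSystem f M)) Q h) :
    algebraMap (DiffPoly R (Fin (m + 1))) (LaurentDiffPoly (DiffPoly R (Fin (m + 1))) (Fin m)) h ∈
      diffIdeal (Set.range (tildeSystem f M)) := by
  refine mem_diffIdeal_of_constantCoeff_eq_zero f M ?_
  have h0 := reachable_genericPoint_eq_zero f M hQ (s := ⟨Set.univ, MvPolynomial.C h⟩) hh
  rw [genericPoint_C] at h0
  rw [← constantCoeff_psHom, ← constantCoeff_partialSpec_zero Set.univ, h0, map_zero]

end Elim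

end System

end DiffSpec

end

/-! ### Termination, well-definedness and membership together -/

theorem mainTheorem3
    {D : Type*} [CommRing D] [IsDomain D] [Algebra ℚ D] [Differential D]
    {m : ℕ} (f : Fin (m + 1) → DiffSpec.LaurentDiffPoly D (Fin m))
    (hP1 : ∀ i, ∃ j, (DiffSpec.diffSupport (f i) j).Nonempty)
    (hP2 : Function.Injective f)
    (hP3 : ∀ j, ∃ i, (DiffSpec.diffSupport (f i) j).Nonempty)
    (hse : DiffSpec.SuperEssential f)
    (M : Fin (m + 1) → ((Fin m × ℕ) →₀ ℤ))
    (hM : ∀ i, M i ∈ (f i).coeff.support)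
    (Q : MvPolynomial (DiffSpec.CIdx (DiffSpec.tildeSystem f M)) ℚ)
    (hQ0 : Q ≠ 0)
    (hQ : Q ∈ DiffSpec.elimIdeal (DiffSpec.tildeSystem f M)) :
    -- every run is finite
    (¬ ∃ r : ℕ → DiffSpec.State (DiffSpec.CIdx (DiffSpec.tildeSystem f M))
        (DiffSpec.DiffPoly D (Fin (m + 1))),
      r 0 = DiffSpec.initial Q ∧
        ∀ t, DiffSpec.Step (DiffSpec.Xi (DiffSpec.tildeSystem f M)) (r t) (r (t + 1))) ∧
    -- every round can be carried out, whatever indeterminate is chosen, and its result is unique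
    (∀ s, DiffSpec.Reachable (DiffSpec.Xi (DiffSpec.tildeSystem f M)) Q s →
      ∀ c, c ∉ s.Δ →
        ∃! H', DiffSpec.Round (DiffSpec.Xi (DiffSpec.tildeSystem f M)) (insert c s.Δ) c s.H H') ∧
    -- every run that has specialized all of the indeterminates returns an output
    (∀ s, DiffSpec.Reachable (DiffSpec.Xi (DiffSpec.tildeSystem f M)) Q s → s.Δ = Set.univ →
      ∃ h, s.H = MvPolynomial.C h) ∧
    -- every output is a nonzero element of the differential elimination ideal
    (∀ h, DiffSpec.IsOutput (DiffSpec.Xi (DiffSpec.tildeSystem f M)) Q h →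
      h ≠ 0 ∧
      algebraMap (DiffSpec.DiffPoly D (Fin (m + 1)))
          (DiffSpec.LaurentDiffPoly (DiffSpec.DiffPoly D (Fin (m + 1))) (Fin m)) h ∈
        DiffSpec.diffIdeal (Set.range (DiffSpec.tildeSystem f M))) := by
  refine ⟨?_, ?_, ?_, ?_⟩
  · rintro ⟨r, -, hr⟩
    exact DiffSpec.not_exists_infinite_run _ ⟨r, hr⟩
  · exact fun s hs c hc => DiffSpec.existsUnique_round _ hc (hs.ne_zero hQ0) hs.partialSpec_eq
  · intro s hs hΔ
    refine DiffSpec.exists_eq_C_of_partialSpec_univ (DiffSpec.Xi (DiffSpec.tildeSystem f M)) ?_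
    have h := hs.partialSpec_eq
    rwa [hΔ] at h
  · intro h hh
    refine ⟨?_, DiffSpec.mem_diffIdeal_of_isOutput f M hQ hh⟩
    rintro rfl
    exact DiffSpec.Reachable.ne_zero hQ0 hh (map_zero _)
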